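/- Let $K$ be a field of characteristic $0$. For $n\ge 0$ let $\operatorname{Der}K[[x_1,\dots,x_n]]$ be the Lie algebra of $K$-linear derivations of the formal power series ring $K[[x_1,\dots,x_n]]$ (formal vector fields), with the commutator bracket. The order of a formal vector field $D$ is $\operatorname{ord} D=-1+\min_i \operatorname{ord} D(x_i)\in\{-1,0,1,\dots\}\cup\{\infty\}$, where the order of a power series is the lowest total degree of a monomial occurring in it, the order of $0$ is $\infty$, and a minimum over the empty set is $\infty$. A *transitive pair* of codimension $n$ over $K$ is a pair $(\mathfrak g,\mathfrak h)$ of a Lie algebra $\mathfrak g$ over $K$ (possibly infinite-dimensional) and a subalgebra $\mathfrak h$ of finite codimension $n$ in $\mathfrak g$. It is *effective* if $\mathfrak h$ contains no non-zero ideal of $\mathfrak g$. A *realisation* of $(\mathfrak g,\mathfrak h)$ is a Lie algebra homomorphism $\phi:\mathfrak g\to\operatorname{Der}K[[x_1,\dots,x_n]]$, with $n=\operatorname{codim}_{\mathfrak g}\mathfrak h$, such that $\mathfrak h=\{X\in\mathfrak g:\operatorname{ord}\phi(X)\ge 0\}$. **Theorem (Realisation Theorem).** Let $(\mathfrak g,\mathfrak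 h)$ be a transitive pair over $K$ of codimension $n$. 1. $(\mathfrak g,\mathfrak h)$ has a realisation. 2. If $\phi_1,\phi_2$ are realisations of $(\mathfrak g,\mathfrak h)$, then there is a unique formal coordinate change, that is, a unique $K$-algebra automorphism $\psi$ of $K[[x_1,\dots,x_n]]$, such that $\phi_2(X)=\psi\,\phi_1(X)\,\psi^{-1}$ for all $X\in\mathfrak g$. 3. For every realisation $\phi$ of $(\mathfrak g,\mathfrak h)$, the kernel of $\phi$ is the largest ideal of $\mathfrak g$ contained in $\mathfrak h$. In particular, $\phi$ is injective if and only if $(\mathfrak g,\mathfrak h)$ is effective. -/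

import Mathlib

/-- Formal vector fields in `n` variables over `K`: the `K`-linear derivations of
`K[[x_1, …, x_n]]`. They form a Lie algebra under the commutator bracket. -/
abbrev FormalVectorField (K : Type*) [Field K] (n : ℕ) : Type _ :=
  Derivation K (MvPowerSeries (Fin n) K) (MvPowerSeries (Fin n) K)

/-- The order `-1 + min_i ord (D x_i)` of a formal vector field `D`. The minimum of the orders is
`∞` if all `D x_i` vanish (in particular if `n = 0`). -/
noncomputable def FormalVectorField.ord {K : Type*} [Field K] {n : ℕ}
    (D : FormalVectorField K n) : WithTop ℤ :=
  ((-1 : ℤ) : WithTop ℤ) +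
    ENat.map (fun k : ℕ => (k : ℤ)) (⨅ i : Fin n, (D (MvPowerSeries.X i)).order)

/-- `(g, h)` is a transitive pair of codimension `n`. -/
structure IsTransitivePair {K g : Type*} [Field K] [LieRing g] [LieAlgebra K g]
    (h : LieSubalgebra K g) (n : ℕ) : Prop where
  finite_codim : Module.Finite K (g ⧸ h.toSubmodule)
  codim_eq : Module.finrank K (g ⧸ h.toSubmodule) = n

/-- `h` contains no non-zero ideal of `g`. -/
def IsEffectivePair {K g : Type*} [Field K] [LieRing g] [LieAlgebra K g]
    (h : LieSubalgebra K g) : Prop :=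
  ∀ I : LieIdeal K g, (I : Set g) ⊆ (h : Set g) → I = ⊥

/-- The Lie algebra homomorphism `φ` is a realisation of the pair `(g, h)`: the number of variables
is the (finite) codimension of `h`, and `h` consists exactly of the elements that `φ` maps to
vector fields of non-negative order. -/
structure IsRealisation {K g : Type*} [Field K] [LieRing g] [LieAlgebra K g]
    (h : LieSubalgebra K g) {n : ℕ} (φ : g →ₗ⁅K⁆ FormalVectorField K n) : Prop where
  transitive : IsTransitivePair h n
  mem_iff : ∀ X : g, X ∈ h ↔ 0 ≤ FormalVectorField.ord (φ X)

/-! Think of `h` as the stabiliser of a point, with coordinates exp X near it, where X = ∑ xᵢ bᵢ and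
the bᵢ lift a basis of g/h. No group is needed: in any representation exp X · v is the power series
F (`flow`) with constant term v and E F = X·F, E being the Euler operator, and the components ωᵢ of
d(exp X) exp(-X) solve E ωᵢ + ωᵢ = bᵢ + [X, ωᵢ]. In characteristic 0 such equations have at most one
solution with given constant term (`eq_of_euler_add`). This yields ∂ᵢ exp X = ωᵢ exp X, the
equivariance `act_flow_flow` and the Maurer–Cartan equation.

Existence: send x to the vector field u with ω(u) ≡ Ad(exp X) x modulo `h`. The matrix of ω modulo
`h` is the identity at the origin, hence invertible. The Maurer–Cartan equation makes x ↦ u a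
homomorphism (`canonicalComponents_lie`).

Uniqueness and kernel: the fields of a realisation span the tangent space at the origin, so orders
of series can be tested by differentiating along them (`mem_orderGE_succ_iff`). By induction on the
order, a linear intertwiner preserving the value at the origin is unique, multiplicative and
bijective, and an ideal inside `h` acts by zero. The map f ↦ (exp X · f)(0) is such an intertwiner
to the canonical realisation (`orbitPullback_intertwines`). -/

namespace FormalSeries

/-! ### Calculus of vector-valued formal power series -/

open Finset.HasAntidiagonal (antidiagonal mem_antidiagonal)
open Finsupp (single degree)

variable {K : Type*} [Field K] {n : ℕ}
variable {U V W Z P : Type*} [AddCommGroup U] [Module K U] [AddCommGroup V] [Module K V]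
  [AddCommGroup W] [Module K W] [AddCommGroup Z] [Module K Z] [AddCommGroup P] [Module K P]

variable (K) in
/-- The coefficient of a power series with coefficients in a vector space. -/
def vcoeff (m : Fin n →₀ ℕ) : MvPowerSeries (Fin n) V →ₗ[K] V :=
  LinearMap.proj (R := K) (φ := fun _ : Fin n →₀ ℕ => V) m

variable (K) in
theorem vext {a b : MvPowerSeries (Fin n) V} (h : ∀ m, vcoeff K m a = vcoeff K m b) : a = b :=
  funext h

theorem coeff_eq_vcoeff (m : Fin n →₀ ℕ) (f : MvPowerSeries (Fin n) K) :
    MvPowerSeries.coeff m f = vcoeff K m f := rfl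

/-- The Cauchy product of vector-valued power series along a bilinear map. -/
noncomputable def cauchy (B : U →ₗ[K] V →ₗ[K] W) :
    MvPowerSeries (Fin n) U →ₗ[K] MvPowerSeries (Fin n) V →ₗ[K] MvPowerSeries (Fin n) W :=
  LinearMap.mk₂ K (fun a b m => ∑ p ∈ antidiagonal m, B (vcoeff K p.1 a) (vcoeff K p.2 b))
    (fun a a' b => funext fun m => by
      simp only [map_add, LinearMap.add_apply, Finset.sum_add_distrib]; rfl)
    (fun c a b => funext fun m => by
      simp only [map_smul, LinearMap.smul_apply, ← Finset.smul_sum]; rfl)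
    (fun a b b' => funext fun m => by
      simp only [map_add, Finset.sum_add_distrib]; rfl)
    (fun c a b => funext fun m => by
      simp only [map_smul, ← Finset.smul_sum]; rfl)

theorem vcoeff_cauchy (B : U →ₗ[K] V →ₗ[K] W) (a : MvPowerSeries (Fin n) U)
    (b : MvPowerSeries (Fin n) V) (m : Fin n →₀ ℕ) :
    vcoeff K m (cauchy B a b) =
      ∑ p ∈ antidiagonal m, B (vcoeff K p.1 a) (vcoeff K p.2 b) := rfl

theorem vcoeff_zero_cauchy (B : U →ₗ[K] V →ₗ[K] W) (a : MvPowerSeries (Fin n) U)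
    (b : MvPowerSeries (Fin n) V) :
    vcoeff K 0 (cauchy B a b) = B (vcoeff K 0 a) (vcoeff K 0 b) := by
  simp [vcoeff_cauchy]

theorem cauchy_flip (B : U →ₗ[K] V →ₗ[K] W) (a : MvPowerSeries (Fin n) U)
    (b : MvPowerSeries (Fin n) V) : cauchy B a b = cauchy B.flip b a := by
  refine vext K fun m => ?_
  conv_rhs => rw [vcoeff_cauchy, ← Finset.HasAntidiagonal.map_swap_antidiagonal, Finset.sum_map]
  rfl

theorem cauchy_assoc {Q : Type*} [AddCommGroup Q] [Module K Q]
    (B₁ : W →ₗ[K] Z →ₗ[K] P) (B₂ : U →ₗ[K] V →ₗ[K] W)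
    (B₃ : U →ₗ[K] Q →ₗ[K] P) (B₄ : V →ₗ[K] Z →ₗ[K] Q)
    (h : ∀ u v z, B₁ (B₂ u v) z = B₃ u (B₄ v z)) (a : MvPowerSeries (Fin n) U)
    (b : MvPowerSeries (Fin n) V) (c : MvPowerSeries (Fin n) Z) :
    cauchy B₁ (cauchy B₂ a b) c = cauchy B₃ a (cauchy B₄ b c) := by
  refine vext K fun m => ?_
  simp only [vcoeff_cauchy, map_sum, LinearMap.sum_apply, h, Finset.sum_sigma']
  refine Finset.sum_nbij' (fun ⟨⟨_i, j⟩, ⟨k, l⟩⟩ ↦ ⟨(k, l + j), (l, j)⟩)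
    (fun ⟨⟨i, _j⟩, ⟨k, l⟩⟩ ↦ ⟨(i + k, l), (i, k)⟩) ?_ ?_ ?_ ?_ ?_ <;>
  · rintro ⟨⟨i, j⟩, ⟨k, l⟩⟩ hx
    simp only [Finset.mem_sigma, mem_antidiagonal] at hx
    obtain ⟨rfl, rfl⟩ := hx
    simp [add_assoc]

theorem cauchy_lie_skew {g : Type*} [LieRing g] [LieAlgebra K g]
    (a b : MvPowerSeries (Fin n) g) :
    cauchy (LieAlgebra.ad K g : g →ₗ[K] Module.End K g) a b =
      -cauchy (LieAlgebra.ad K g : g →ₗ[K] Module.End K g) b a := by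
  rw [cauchy_flip]
  refine vext K fun m => ?_
  rw [map_neg, vcoeff_cauchy, vcoeff_cauchy, ← Finset.sum_neg_distrib]
  exact Finset.sum_congr rfl fun p _ => (lie_skew _ _).symm

/-- Coefficientwise application of a linear map. -/
def mapCoeff (T : V →ₗ[K] W) : MvPowerSeries (Fin n) V →ₗ[K] MvPowerSeries (Fin n) W :=
  LinearMap.pi (R := K) (φ := fun _ : Fin n →₀ ℕ => W) fun m => T ∘ₗ vcoeff K m

@[simp] theorem vcoeff_mapCoeff (T : V →ₗ[K] W) (a : MvPowerSeries (Fin n) V) (m : Fin n →₀ ℕ) :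
    vcoeff K m (mapCoeff T a) = T (vcoeff K m a) := rfl

/-- Multiplication of a vector-valued power series by a scalar power series. -/
noncomputable def smulSeries : MvPowerSeries (Fin n) K →ₗ[K] MvPowerSeries (Fin n) V →ₗ[K]
    MvPowerSeries (Fin n) V :=
  cauchy (LinearMap.lsmul K V : K →ₗ[K] V →ₗ[K] V)

theorem smulSeries_eq_mul (f a : MvPowerSeries (Fin n) K) : smulSeries f a = f * a := by
  refine MvPowerSeries.ext fun m => ?_
  rw [MvPowerSeries.coeff_mul]
  rfl

theorem mapCoeff_smulSeries (T : V →ₗ[K] W) (f : MvPowerSeries (Fin n) K)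
    (a : MvPowerSeries (Fin n) V) :
    mapCoeff T (smulSeries f a) = smulSeries f (mapCoeff T a) := by
  refine vext K fun m => ?_
  simp [smulSeries, vcoeff_cauchy]

theorem cauchy_smulSeries_left (B : U →ₗ[K] V →ₗ[K] W) (f : MvPowerSeries (Fin n) K)
    (a : MvPowerSeries (Fin n) U) (b : MvPowerSeries (Fin n) V) :
    cauchy B (smulSeries f a) b = smulSeries f (cauchy B a b) :=
  cauchy_assoc _ _ _ _ (fun u v z => by simp) f a b

theorem cauchy_smulSeries_right (B : U →ₗ[K] V →ₗ[K] W) (f : MvPowerSeries (Fin n) K)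
    (a : MvPowerSeries (Fin n) U) (b : MvPowerSeries (Fin n) V) :
    cauchy B a (smulSeries f b) = smulSeries f (cauchy B a b) := by
  rw [cauchy_flip, cauchy_smulSeries_left, cauchy_flip B]

theorem smulSeries_smulSeries (f g : MvPowerSeries (Fin n) K) (a : MvPowerSeries (Fin n) V) :
    smulSeries f (smulSeries g a) = smulSeries (f * g) a := by
  rw [← smulSeries_eq_mul]
  exact (cauchy_assoc _ _ _ _ (fun u v z => by simp [smul_smul, mul_comm]) f g a).symm

variable (K) in
/-- The constant power series. -/
noncomputable def const : V →ₗ[K] MvPowerSeries (Fin n) V :=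
  LinearMap.single K (fun _ : Fin n →₀ ℕ => V) 0

theorem vcoeff_zero_const (v : V) : vcoeff K (0 : Fin n →₀ ℕ) (const K v) = v :=
  Pi.single_eq_same (M := fun _ : Fin n →₀ ℕ => V) 0 v

theorem vcoeff_const_of_ne {m : Fin n →₀ ℕ} (hm : m ≠ 0) (v : V) :
    vcoeff K m (const K v) = 0 :=
  Pi.single_eq_of_ne (M := fun _ : Fin n →₀ ℕ => V) hm v

theorem cauchy_const (B : U →ₗ[K] V →ₗ[K] W) (u : U) (b : MvPowerSeries (Fin n) V) :
    cauchy B (const K u) b = mapCoeff (B u) b := by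
  refine vext K fun m => ?_
  rw [vcoeff_cauchy, vcoeff_mapCoeff, Finset.sum_eq_single (0, m)]
  · rw [vcoeff_zero_const]
  · rintro ⟨p, q⟩ hp hne
    have : p ≠ 0 := by
      rintro rfl
      simp_all
    rw [vcoeff_const_of_ne this, map_zero, LinearMap.zero_apply]
  · simp

theorem one_eq_const : (1 : MvPowerSeries (Fin n) K) = const K (1 : K) := by
  refine MvPowerSeries.ext fun m => ?_
  rw [MvPowerSeries.coeff_one, coeff_eq_vcoeff]
  split_ifs with h
  · rw [h, vcoeff_zero_const]
  · rw [vcoeff_const_of_ne h]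

theorem smulSeries_one (a : MvPowerSeries (Fin n) V) :
    smulSeries (1 : MvPowerSeries (Fin n) K) a = a := by
  rw [one_eq_const, smulSeries, cauchy_const]
  exact vext K fun m => by simp

theorem vcoeff_X_smulSeries_add (i : Fin n) (a : MvPowerSeries (Fin n) V) (m : Fin n →₀ ℕ) :
    vcoeff K (m + single i 1) (smulSeries (MvPowerSeries.X i : MvPowerSeries (Fin n) K) a) =
      vcoeff K m a := by
  rw [smulSeries, vcoeff_cauchy, Finset.sum_eq_single (single i 1, m)]
  · simp [← coeff_eq_vcoeff]
  · rintro ⟨p, q⟩ hp hne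
    have : p ≠ single i 1 := by
      rintro rfl
      rw [mem_antidiagonal, add_comm m] at hp
      simp_all
    simp [← coeff_eq_vcoeff, MvPowerSeries.coeff_X, this]
  · simp [add_comm]

theorem vcoeff_X_smulSeries_of_eq_zero {i : Fin n} (a : MvPowerSeries (Fin n) V)
    {m : Fin n →₀ ℕ} (hm : m i = 0) :
    vcoeff K m (smulSeries (MvPowerSeries.X i : MvPowerSeries (Fin n) K) a) = 0 := by
  rw [smulSeries, vcoeff_cauchy]
  refine Finset.sum_eq_zero ?_
  rintro ⟨p, q⟩ hp
  have : p ≠ single i 1 := by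
    rintro rfl
    rw [mem_antidiagonal] at hp
    simp [← hp] at hm
  simp [← coeff_eq_vcoeff, MvPowerSeries.coeff_X, this]

theorem exists_eq_add_single {m : Fin n →₀ ℕ} {i : Fin n} (h : m i ≠ 0) :
    ∃ k, m = k + single i 1 :=
  ⟨m - single i 1, (tsub_add_cancel_of_le (by simpa using Nat.one_le_iff_ne_zero.2 h)).symm⟩

variable (K) in
/-- The partial derivative of a vector-valued power series. -/
noncomputable def pd (i : Fin n) : MvPowerSeries (Fin n) V →ₗ[K] MvPowerSeries (Fin n) V :=
  LinearMap.pi (R := K) (φ := fun _ : Fin n →₀ ℕ => V) fun m =>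
    ((m i : K) + 1) • vcoeff K (m + single i 1)

theorem vcoeff_pd (i : Fin n) (a : MvPowerSeries (Fin n) V) (m : Fin n →₀ ℕ) :
    vcoeff K m (pd K i a) = ((m i : K) + 1) • vcoeff K (m + single i 1) a := rfl

theorem pd_eq_pderiv (i : Fin n) (f : MvPowerSeries (Fin n) K) :
    pd K i f = MvPowerSeries.pderiv K i f := by
  refine MvPowerSeries.ext fun m => ?_
  rw [MvPowerSeries.coeff_pderiv, coeff_eq_vcoeff, vcoeff_pd, smul_eq_mul, mul_comm,
    coeff_eq_vcoeff]

variable (K) in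
/-- The derivation multiplying the coefficient of index `m` by `w m`. -/
noncomputable def weightDer (w : (Fin n →₀ ℕ) →+ ℕ) : MvPowerSeries (Fin n) V →ₗ[K] MvPowerSeries (Fin n) V :=
  LinearMap.pi (R := K) (φ := fun _ : Fin n →₀ ℕ => V) fun m => (w m : K) • vcoeff K m

theorem vcoeff_weightDer (w : (Fin n →₀ ℕ) →+ ℕ) (a : MvPowerSeries (Fin n) V)
    (m : Fin n →₀ ℕ) : vcoeff K m (weightDer K w a) = (w m : K) • vcoeff K m a := rfl

theorem weightDer_cauchy (w : (Fin n →₀ ℕ) →+ ℕ) (B : U →ₗ[K] V →ₗ[K] W)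
    (a : MvPowerSeries (Fin n) U) (b : MvPowerSeries (Fin n) V) :
    weightDer K w (cauchy B a b) =
      cauchy B (weightDer K w a) b + cauchy B a (weightDer K w b) := by
  refine vext K fun m => ?_
  rw [map_add, vcoeff_weightDer, vcoeff_cauchy, vcoeff_cauchy, vcoeff_cauchy, Finset.smul_sum,
    ← Finset.sum_add_distrib]
  refine Finset.sum_congr rfl fun p hp => ?_
  rw [mem_antidiagonal] at hp
  rw [vcoeff_weightDer, vcoeff_weightDer, ← hp, map_add]
  simp [add_smul]

theorem mapCoeff_pd (i : Fin n) (T : V →ₗ[K] W) (a : MvPowerSeries (Fin n) V) :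
    mapCoeff T (pd K i a) = pd K i (mapCoeff T a) := by
  refine vext K fun m => ?_
  simp [vcoeff_pd]

theorem X_smulSeries_pd (i : Fin n) (a : MvPowerSeries (Fin n) V) :
    smulSeries (MvPowerSeries.X i : MvPowerSeries (Fin n) K) (pd K i a) =
      weightDer K (Finsupp.applyAddHom i) a := by
  refine vext K fun m => ?_
  rw [vcoeff_weightDer]
  by_cases hm : m i = 0
  · rw [vcoeff_X_smulSeries_of_eq_zero _ hm]
    simp [hm]
  · obtain ⟨k, rfl⟩ := exists_eq_add_single hm
    rw [vcoeff_X_smulSeries_add, vcoeff_pd]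
    simp

theorem X_smulSeries_injective (i : Fin n) :
    Function.Injective
      (smulSeries (V := V) (MvPowerSeries.X i : MvPowerSeries (Fin n) K)) := fun a b h =>
  vext K fun m => by
    rw [← vcoeff_X_smulSeries_add i, h, vcoeff_X_smulSeries_add i]

/-- After multiplication by xᵢ, which is injective, ∂ᵢ becomes the weight operator xᵢ∂ᵢ. Its Leibniz
rule is just additivity of the weight on exponents. -/
theorem pd_cauchy (i : Fin n) (B : U →ₗ[K] V →ₗ[K] W)
    (a : MvPowerSeries (Fin n) U) (b : MvPowerSeries (Fin n) V) :
    pd K i (cauchy B a b) =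
      cauchy B (pd K i a) b + cauchy B a (pd K i b) := by
  apply X_smulSeries_injective (K := K) i
  rw [map_add, X_smulSeries_pd, weightDer_cauchy, ← X_smulSeries_pd, ← X_smulSeries_pd,
    cauchy_smulSeries_left, cauchy_smulSeries_right]

theorem pd_smulSeries (i : Fin n) (f : MvPowerSeries (Fin n) K) (a : MvPowerSeries (Fin n) V) :
    pd K i (smulSeries f a) =
      smulSeries (MvPowerSeries.pderiv K i f) a + smulSeries f (pd K i a) := by
  rw [smulSeries, pd_cauchy, pd_eq_pderiv]

theorem pd_const (i : Fin n) (v : V) :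
    pd K i (const K v : MvPowerSeries (Fin n) V) = 0 := by
  refine vext K fun m => ?_
  rw [vcoeff_pd, vcoeff_const_of_ne, smul_zero, map_zero]
  intro h
  simpa using DFunLike.congr_fun h i

variable (K n) in
/-- The Euler operator, multiplying the homogeneous part of degree `d` by `d`. -/
noncomputable def euler (V : Type*) [AddCommGroup V] [Module K V] :
    MvPowerSeries (Fin n) V →ₗ[K] MvPowerSeries (Fin n) V :=
  weightDer K (Finsupp.degree (R := ℕ) (σ := Fin n))

theorem vcoeff_euler (a : MvPowerSeries (Fin n) V) (m : Fin n →₀ ℕ) :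
    vcoeff K m (euler K n V a) = ((degree m : ℕ) : K) • vcoeff K m a := rfl

/-- ∂ᵢ lowers the degree by one; hence differentiating a solution of an Euler equation raises its
constant c by one. -/
theorem pd_euler (i : Fin n) (a : MvPowerSeries (Fin n) V) :
    pd K i (euler K n V a) = euler K n V (pd K i a) + pd K i a := by
  refine vext K fun m => ?_
  rw [map_add, vcoeff_pd, vcoeff_euler, vcoeff_euler, vcoeff_pd, map_add, smul_smul, smul_smul,
    ← add_smul]
  congr 1
  simp
  ring

end FormalSeries

/-! ### The formal exponential and the Maurer–Cartan form -/

namespace FormalSeries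

open Finset.HasAntidiagonal (antidiagonal mem_antidiagonal)
open Finsupp (single degree)
attribute [local instance] LieRing.ofAssociativeRing LieAlgebra.ofAssociativeAlgebra

variable {K : Type*} [Field K] {n : ℕ}
variable {g : Type*} [LieRing g] [LieAlgebra K g]
variable {V : Type*} [AddCommGroup V] [Module K V]

/-- The pairing of `g`-valued and `V`-valued power series induced by a representation on `V`. -/
noncomputable def act (ρ : g →ₗ⁅K⁆ Module.End K V) :
    MvPowerSeries (Fin n) g →ₗ[K] MvPowerSeries (Fin n) V →ₗ[K] MvPowerSeries (Fin n) V :=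
  cauchy (ρ : g →ₗ[K] Module.End K V)

/-- The action of the generic element `∑ xᵢ bᵢ` on `V`-valued power series. -/
noncomputable def genericAct (b : Fin n → g) (ρ : g →ₗ⁅K⁆ Module.End K V) :
    MvPowerSeries (Fin n) V →ₗ[K] MvPowerSeries (Fin n) V :=
  ∑ i, smulSeries (MvPowerSeries.X i : MvPowerSeries (Fin n) K) ∘ₗ mapCoeff (ρ (b i))

theorem genericAct_apply (b : Fin n → g) (ρ : g →ₗ⁅K⁆ Module.End K V)
    (a : MvPowerSeries (Fin n) V) :
    genericAct b ρ a =
      ∑ i, smulSeries (MvPowerSeries.X i : MvPowerSeries (Fin n) K) (mapCoeff (ρ (b i)) a) := by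
  simp [genericAct]

theorem vcoeff_zero_genericAct (b : Fin n → g) (ρ : g →ₗ⁅K⁆ Module.End K V)
    (a : MvPowerSeries (Fin n) V) : vcoeff K 0 (genericAct b ρ a) = 0 := by
  rw [genericAct_apply, map_sum]
  exact Finset.sum_eq_zero fun i _ => vcoeff_X_smulSeries_of_eq_zero _ (by simp)

/-- X is homogeneous of degree 1; this turns the Euler equation into a recursion on the degree. -/
theorem vcoeff_genericAct_congr (b : Fin n → g) (ρ : g →ₗ⁅K⁆ Module.End K V)
    {a a' : MvPowerSeries (Fin n) V} {m : Fin n →₀ ℕ}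
    (h : ∀ k : Fin n →₀ ℕ, degree k + 1 = degree m → vcoeff K k a = vcoeff K k a') :
    vcoeff K m (genericAct b ρ a) = vcoeff K m (genericAct b ρ a') := by
  rw [genericAct_apply, genericAct_apply, map_sum, map_sum]
  refine Finset.sum_congr rfl fun i _ => ?_
  by_cases hm : m i = 0
  · rw [vcoeff_X_smulSeries_of_eq_zero _ hm, vcoeff_X_smulSeries_of_eq_zero _ hm]
  · obtain ⟨k, rfl⟩ := exists_eq_add_single hm
    rw [vcoeff_X_smulSeries_add, vcoeff_X_smulSeries_add, vcoeff_mapCoeff, vcoeff_mapCoeff,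
      h k (by simp)]

theorem mapCoeff_act (ρ : g →ₗ⁅K⁆ Module.End K V) (x : g) (a : MvPowerSeries (Fin n) g)
    (F : MvPowerSeries (Fin n) V) :
    mapCoeff (ρ x) (act ρ a F) =
      act ρ (mapCoeff (LieAlgebra.ad K g x) a) F + act ρ a (mapCoeff (ρ x) F) := by
  refine vext K fun m => ?_
  rw [map_add, vcoeff_mapCoeff, act, vcoeff_cauchy, vcoeff_cauchy, vcoeff_cauchy, map_sum,
    ← Finset.sum_add_distrib]
  refine Finset.sum_congr rfl fun p _ => ?_
  simp [LieHom.map_lie, LieRing.of_associative_ring_bracket]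

theorem genericAct_act (b : Fin n → g) (ρ : g →ₗ⁅K⁆ Module.End K V)
    (a : MvPowerSeries (Fin n) g) (F : MvPowerSeries (Fin n) V) :
    genericAct b ρ (act ρ a F) =
      act ρ (genericAct b (LieAlgebra.ad K g) a) F + act ρ a (genericAct b ρ F) := by
  simp only [genericAct_apply, map_sum, LinearMap.sum_apply, ← Finset.sum_add_distrib,
    mapCoeff_act, map_add]
  refine Finset.sum_congr rfl fun i _ => ?_
  rw [act, cauchy_smulSeries_left, cauchy_smulSeries_right]

theorem pd_genericAct (b : Fin n → g) (ρ : g →ₗ⁅K⁆ Module.End K V) (i : Fin n)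
    (F : MvPowerSeries (Fin n) V) :
    pd K i (genericAct b ρ F) = mapCoeff (ρ (b i)) F + genericAct b ρ (pd K i F) := by
  simp only [genericAct_apply, map_sum, pd_smulSeries, Finset.sum_add_distrib, mapCoeff_pd]
  congr 1
  rw [Finset.sum_eq_single i]
  · rw [MvPowerSeries.pderiv_X_self, smulSeries_one]
  · intro j _ hj
    rw [MvPowerSeries.pderiv_X_of_ne hj, map_zero, LinearMap.zero_apply]
  · simp

theorem euler_act (ρ : g →ₗ⁅K⁆ Module.End K V)
    (a : MvPowerSeries (Fin n) g) (F : MvPowerSeries (Fin n) V) :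
    euler K n V (act ρ a F) = act ρ (euler K n g a) F + act ρ a (euler K n V F) :=
  weightDer_cauchy _ _ _ _

theorem act_const (ρ : g →ₗ⁅K⁆ Module.End K V) (x : g) (F : MvPowerSeries (Fin n) V) :
    act ρ (const K x) F = mapCoeff (ρ x) F :=
  cauchy_const _ _ _

theorem act_ad_skew (a b : MvPowerSeries (Fin n) g) :
    act (LieAlgebra.ad K g) a b = -act (LieAlgebra.ad K g) b a :=
  cauchy_lie_skew a b

theorem act_smulSeries_left (ρ : g →ₗ⁅K⁆ Module.End K V) (f : MvPowerSeries (Fin n) K)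
    (a : MvPowerSeries (Fin n) g) (F : MvPowerSeries (Fin n) V) :
    act ρ (smulSeries f a) F = smulSeries f (act ρ a F) :=
  cauchy_smulSeries_left _ _ _ _

theorem act_smulSeries_right (ρ : g →ₗ⁅K⁆ Module.End K V) (f : MvPowerSeries (Fin n) K)
    (a : MvPowerSeries (Fin n) g) (F : MvPowerSeries (Fin n) V) :
    act ρ a (smulSeries f F) = smulSeries f (act ρ a F) :=
  cauchy_smulSeries_right _ _ _ _

/-- Solutions of `E F + c F = [∑ xᵢ bᵢ, F]` are determined by their constant term. -/
theorem eq_zero_of_euler_add [CharZero K] (b : Fin n → g) (ρ : g →ₗ⁅K⁆ Module.End K V) (c : ℕ)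
    {F : MvPowerSeries (Fin n) V} (h0 : vcoeff K 0 F = 0)
    (hF : euler K n V F + (c : K) • F = genericAct b ρ F) : F = 0 := by
  suffices ∀ d : ℕ, ∀ m : Fin n →₀ ℕ, degree m = d → vcoeff K m F = 0 from
    vext K fun m => this _ m rfl
  intro d
  induction d with
  | zero =>
    intro m hm
    rw [Finsupp.degree_eq_zero_iff] at hm
    rw [hm, h0]
  | succ d ih =>
    intro m hm
    have h1 := congrArg (vcoeff K m) hF
    rw [vcoeff_genericAct_congr (a' := 0) b ρ fun k hk => ih k (by omega), map_zero, map_zero,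
      map_add, map_smul, vcoeff_euler, ← add_smul, hm, ← Nat.cast_add, smul_eq_zero,
      Nat.cast_eq_zero] at h1
    exact h1.resolve_left (by omega)

/-- The main tool for the identities below: both sides solve one equation, with common inhomogeneity
`H`, and agree at the origin. -/
theorem eq_of_euler_add [CharZero K] (b : Fin n → g) (ρ : g →ₗ⁅K⁆ Module.End K V) (c : ℕ)
    {F G H : MvPowerSeries (Fin n) V} (h0 : vcoeff K 0 F = vcoeff K 0 G)
    (hF : euler K n V F + (c : K) • F = H + genericAct b ρ F)
    (hG : euler K n V G + (c : K) • G = H + genericAct b ρ G) : F = G := by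
  refine sub_eq_zero.1 (eq_zero_of_euler_add b ρ c (by rw [map_sub, h0, sub_self]) ?_)
  rw [map_sub, map_sub, smul_sub, sub_add_sub_comm, hF, hG, add_sub_add_left_eq_sub]

/-- The degreewise approximations of `eulerSolution`. -/
noncomputable def eulerSolutionAux (b : Fin n → g) (ρ : g →ₗ⁅K⁆ Module.End K V) (c : ℕ) :
    ℕ → V →ₗ[K] MvPowerSeries (Fin n) V
  | 0 => const K
  -- E + c acts as d + 1 + c in degree d + 1. This gives Xᵈv/d! for c = 0 and Xᵈv/(d+1)! for c = 1.
  | d + 1 => ((d + 1 + c : ℕ) : K)⁻¹ • (genericAct b ρ ∘ₗ eulerSolutionAux b ρ c d)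

/-- The solution of `E F + c F = c v + [∑ xᵢ bᵢ, F]` with constant term `v`. -/
noncomputable def eulerSolution (b : Fin n → g) (ρ : g →ₗ⁅K⁆ Module.End K V) (c : ℕ) :
    V →ₗ[K] MvPowerSeries (Fin n) V :=
  LinearMap.pi (R := K) (φ := fun _ : Fin n →₀ ℕ => V) fun m =>
    vcoeff K m ∘ₗ eulerSolutionAux b ρ c (degree m)

theorem vcoeff_eulerSolution (b : Fin n → g) (ρ : g →ₗ⁅K⁆ Module.End K V) (c : ℕ) (v : V)
    (m : Fin n →₀ ℕ) : vcoeff K m (eulerSolution b ρ c v) =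
      vcoeff K m (eulerSolutionAux b ρ c (degree m) v) := rfl

theorem vcoeff_zero_eulerSolution (b : Fin n → g) (ρ : g →ₗ⁅K⁆ Module.End K V) (c : ℕ) (v : V) :
    vcoeff K 0 (eulerSolution b ρ c v) = v := by
  rw [vcoeff_eulerSolution, map_zero]
  exact vcoeff_zero_const v

theorem euler_eulerSolution [CharZero K] (b : Fin n → g) (ρ : g →ₗ⁅K⁆ Module.End K V) (c : ℕ)
    (v : V) : euler K n V (eulerSolution b ρ c v) + (c : K) • eulerSolution b ρ c v =
      (c : K) • const K v + genericAct b ρ (eulerSolution b ρ c v) := by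
  refine vext K fun m => ?_
  rw [map_add, map_add, map_smul, map_smul, vcoeff_euler]
  by_cases hm : m = 0
  · subst hm
    rw [vcoeff_zero_genericAct, vcoeff_zero_const, vcoeff_zero_eulerSolution]
    simp
  · rw [vcoeff_const_of_ne hm, smul_zero, zero_add, ← add_smul, ← Nat.cast_add,
      vcoeff_eulerSolution]
    obtain ⟨d, hd⟩ := Nat.exists_eq_succ_of_ne_zero ((Finsupp.degree_eq_zero_iff m).not.2 hm)
    rw [vcoeff_genericAct_congr (a' := eulerSolutionAux b ρ c d v) b ρ fun k hk => ?_, hd]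
    · have : ((d + 1 + c : ℕ) : K) ≠ 0 := Nat.cast_ne_zero.2 (by omega)
      rw [eulerSolutionAux, LinearMap.smul_apply, map_smul, smul_smul, Nat.succ_eq_add_one,
        mul_inv_cancel₀ this, one_smul]
      rfl
    · rw [vcoeff_eulerSolution]
      congr 3
      omega

/-- The flow of the generic element: the formal expression `exp (∑ xᵢ bᵢ) v`. -/
noncomputable def flow (b : Fin n → g) (ρ : g →ₗ⁅K⁆ Module.End K V) :
    V →ₗ[K] MvPowerSeries (Fin n) V :=
  eulerSolution b ρ 0

/-- The components of the pull-back of the Maurer–Cartan form along `exp (∑ xᵢ bᵢ)`. -/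
noncomputable def maurerCartan (K : Type*) [Field K] [LieAlgebra K g] (b : Fin n → g)
    (i : Fin n) : MvPowerSeries (Fin n) g :=
  eulerSolution b (LieAlgebra.ad K g) 1 (b i)

theorem vcoeff_zero_flow (b : Fin n → g) (ρ : g →ₗ⁅K⁆ Module.End K V) (v : V) :
    vcoeff K 0 (flow b ρ v) = v :=
  vcoeff_zero_eulerSolution _ _ _ _

theorem vcoeff_zero_maurerCartan (b : Fin n → g) (i : Fin n) :
    vcoeff K 0 (maurerCartan K b i) = b i :=
  vcoeff_zero_eulerSolution _ _ _ _

theorem vcoeff_zero_pd (i : Fin n) (F : MvPowerSeries (Fin n) V) :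
    vcoeff K 0 (pd K i F) = vcoeff K (single i 1) F := by
  simp [vcoeff_pd]

variable [CharZero K]

theorem euler_flow (b : Fin n → g) (ρ : g →ₗ⁅K⁆ Module.End K V) (v : V) :
    euler K n V (flow b ρ v) = genericAct b ρ (flow b ρ v) := by
  simpa [flow] using euler_eulerSolution b ρ 0 v

theorem euler_maurerCartan (b : Fin n → g) (i : Fin n) :
    euler K n g (maurerCartan K b i) = const K (b i) +
      genericAct b (LieAlgebra.ad K g) (maurerCartan K b i) - maurerCartan K b i := by
  have := euler_eulerSolution b (LieAlgebra.ad K g) 1 (b i)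
  rw [Nat.cast_one, one_smul, one_smul] at this
  exact eq_sub_of_add_eq this

theorem vcoeff_single_flow (b : Fin n → g) (ρ : g →ₗ⁅K⁆ Module.End K V) (v : V) (i : Fin n) :
    vcoeff K (single i 1) (flow b ρ v) = ρ (b i) v := by
  have h := congrArg (vcoeff K 0) (congrArg (pd K i) (euler_flow b ρ v))
  rw [pd_euler, pd_genericAct, map_add, map_add, vcoeff_zero_genericAct, vcoeff_mapCoeff,
    vcoeff_zero_flow, vcoeff_euler, vcoeff_zero_pd] at h
  simpa using h

/-- Both sides satisfy the Euler equation with c = 1 and inhomogeneity bᵢ · exp X v. -/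
theorem pd_flow (b : Fin n → g) (ρ : g →ₗ⁅K⁆ Module.End K V) (v : V) (i : Fin n) :
    pd K i (flow b ρ v) = act ρ (maurerCartan K b i) (flow b ρ v) := by
  refine eq_of_euler_add b ρ 1 (H := mapCoeff (ρ (b i)) (flow b ρ v)) ?_ ?_ ?_
  · rw [vcoeff_zero_pd, vcoeff_single_flow, act, vcoeff_zero_cauchy, vcoeff_zero_maurerCartan,
      vcoeff_zero_flow]
    rfl
  · rw [Nat.cast_one, one_smul, ← pd_euler, euler_flow, pd_genericAct]
  · rw [Nat.cast_one, one_smul, euler_act, euler_flow, euler_maurerCartan, genericAct_act,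
      map_sub, map_add, LinearMap.sub_apply, LinearMap.add_apply, act_const]
    abel

/-- This is (Ad(exp X) x) exp X = exp X x; X acts as a derivation of the pairing, so both sides
solve the equation with c = 0. -/
theorem act_flow_flow (b : Fin n → g) (ρ : g →ₗ⁅K⁆ Module.End K V) (x : g) (v : V) :
    act ρ (flow b (LieAlgebra.ad K g) x) (flow b ρ v) = flow b ρ (ρ x v) := by
  refine eq_of_euler_add b ρ 0 (H := 0) ?_ ?_ ?_
  · rw [act, vcoeff_zero_cauchy, vcoeff_zero_flow, vcoeff_zero_flow, vcoeff_zero_flow]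
    rfl
  · rw [euler_act, euler_flow, euler_flow, genericAct_act]
    simp
  · rw [euler_flow]
    simp

theorem vcoeff_single_maurerCartan (b : Fin n → g) (i j : Fin n) :
    (2 : K) • vcoeff K (single i 1) (maurerCartan K b j) = ⁅b i, b j⁆ := by
  have h := congrArg (vcoeff K 0) (congrArg (pd K i) (euler_maurerCartan (K := K) b j))
  rw [pd_euler, map_sub (pd K i), map_add (pd K i), pd_const, pd_genericAct, zero_add, map_sub,
    map_add, map_add, vcoeff_zero_genericAct, vcoeff_mapCoeff, vcoeff_zero_maurerCartan, vcoeff_euler,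
    vcoeff_zero_pd] at h
  simp only [map_zero, Nat.cast_zero, zero_smul, zero_add, add_zero, LieAlgebra.ad_apply] at h
  rw [two_smul]
  exact add_eq_of_eq_sub h

/-- The Maurer–Cartan equation. -/
theorem pd_maurerCartan_sub (b : Fin n → g) (i j : Fin n) :
    pd K i (maurerCartan K b j) - pd K j (maurerCartan K b i) =
      act (LieAlgebra.ad K g) (maurerCartan K b i) (maurerCartan K b j) := by
  have hpd : ∀ i j, euler K n g (pd K i (maurerCartan K b j)) =
      mapCoeff (LieAlgebra.ad K g (b i)) (maurerCartan K b j) +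
        genericAct b (LieAlgebra.ad K g) (pd K i (maurerCartan K b j)) -
        (2 : K) • pd K i (maurerCartan K b j) := by
    intro i j
    have := congrArg (pd K i) (euler_maurerCartan (K := K) b j)
    rw [pd_euler, map_sub, map_add, pd_const, pd_genericAct, zero_add] at this
    rw [two_smul, ← sub_sub, ← this, add_sub_cancel_right]
  -- ω has c = 1, and one derivative, or a bracket of two copies of ω, makes it 2.
  refine eq_of_euler_add b (LieAlgebra.ad K g) 2
    (H := mapCoeff (LieAlgebra.ad K g (b i)) (maurerCartan K b j) -
      mapCoeff (LieAlgebra.ad K g (b j)) (maurerCartan K b i)) ?_ ?_ ?_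
  · rw [map_sub, vcoeff_zero_pd, vcoeff_zero_pd, act, vcoeff_zero_cauchy,
      vcoeff_zero_maurerCartan, vcoeff_zero_maurerCartan]
    -- The linear part of ωⱼ is ½[X, bⱼ], so the left side starts with ½[bᵢ, bⱼ] - ½[bⱼ, bᵢ].
    have h2 : (2 : K) ≠ 0 := two_ne_zero
    apply smul_right_injective g h2
    simp only [smul_sub, vcoeff_single_maurerCartan]
    rw [two_smul, ← lie_skew (b j) (b i), sub_neg_eq_add]
    simp
  · rw [map_sub, hpd, hpd, map_sub, Nat.cast_ofNat, smul_sub]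
    abel
  · rw [euler_act, euler_maurerCartan, euler_maurerCartan, genericAct_act, map_sub, map_sub,
      map_add, map_add, LinearMap.sub_apply, LinearMap.add_apply, act_const,
      act_ad_skew _ (const K (b j)), act_const, Nat.cast_ofNat, two_smul]
    abel

end FormalSeries

/-! ### Order filtration and derivations of the power series ring -/

namespace FormalSeries

open Finset.HasAntidiagonal (antidiagonal mem_antidiagonal)
open Finsupp (single degree)

variable {K : Type*} [Field K] {n : ℕ}

variable (K n) in
/-- The power series without monomials of degree less than `N`. -/
def orderGE (N : ℕ) : Submodule K (MvPowerSeries (Fin n) K) where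
  carrier := {f | ∀ m : Fin n →₀ ℕ, degree m < N → MvPowerSeries.coeff m f = 0}
  add_mem' hf hg m hm := by rw [map_add, hf m hm, hg m hm, add_zero]
  zero_mem' m _ := map_zero _
  smul_mem' c f hf m hm := by rw [map_smul, hf m hm, smul_zero]

theorem mem_orderGE_zero (f : MvPowerSeries (Fin n) K) : f ∈ orderGE K n 0 :=
  fun _ hm => absurd hm (Nat.not_lt_zero _)

theorem eq_zero_of_mem_orderGE {f : MvPowerSeries (Fin n) K} (h : ∀ N, f ∈ orderGE K n N) :
    f = 0 :=
  MvPowerSeries.ext fun m => h (degree m + 1) m (Nat.lt_succ_self _)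

theorem mul_mem_orderGE {N : ℕ} (f : MvPowerSeries (Fin n) K) {f' : MvPowerSeries (Fin n) K}
    (h : f' ∈ orderGE K n N) : f * f' ∈ orderGE K n N := fun m hm => by
  rw [MvPowerSeries.coeff_mul]
  refine Finset.sum_eq_zero fun p hp => ?_
  rw [mem_antidiagonal] at hp
  rw [h p.2, mul_zero]
  rw [← hp, map_add] at hm
  omega

theorem pderiv_mem_orderGE {N : ℕ} {f : MvPowerSeries (Fin n) K} (h : f ∈ orderGE K n (N + 1))
    (i : Fin n) : MvPowerSeries.pderiv K i f ∈ orderGE K n N := fun m hm => by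
  rw [MvPowerSeries.coeff_pderiv, h _ (by simpa using hm), zero_mul]

theorem coeff_mul_of_mem_orderGE (f : MvPowerSeries (Fin n) K) {f' : MvPowerSeries (Fin n) K}
    {m : Fin n →₀ ℕ} (h : f' ∈ orderGE K n (degree m)) :
    MvPowerSeries.coeff m (f * f') =
      MvPowerSeries.constantCoeff f * MvPowerSeries.coeff m f' := by
  rw [MvPowerSeries.coeff_mul, Finset.sum_eq_single (0, m)]
  · simp
  · rintro ⟨p, q⟩ hp hne
    rw [mem_antidiagonal] at hp
    have hp0 : p ≠ 0 := by
      rintro rfl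
      simp_all
    have := (Finsupp.degree_eq_zero_iff p).not.2 hp0
    rw [h q, mul_zero]
    simp only at hp
    rw [← hp, map_add]
    omega
  · simp

theorem exists_eq_C_add_sum [CharZero K] (f : MvPowerSeries (Fin n) K) :
    ∃ f' : Fin n → MvPowerSeries (Fin n) K,
      f = MvPowerSeries.C (MvPowerSeries.constantCoeff f) + ∑ i, MvPowerSeries.X i * f' i := by
  -- Dividing by the degree inverts E off the constants, and E G = ∑ xᵢ ∂ᵢG. In degree 0 the value
  -- is 0⁻¹ = 0.
  let G : MvPowerSeries (Fin n) K := fun m => ((degree m : ℕ) : K)⁻¹ * MvPowerSeries.coeff m f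
  refine ⟨fun i => MvPowerSeries.pderiv K i G, MvPowerSeries.ext fun m => ?_⟩
  have h1 : ∀ i, MvPowerSeries.coeff m (MvPowerSeries.X i * MvPowerSeries.pderiv K i G) =
      (m i : K) * (((degree m : ℕ) : K)⁻¹ * MvPowerSeries.coeff m f) := fun i => by
    rw [← smulSeries_eq_mul, ← pd_eq_pderiv, X_smulSeries_pd]
    rfl
  rw [map_add, map_sum, Finset.sum_congr rfl fun i _ => h1 i, ← Finset.sum_mul, ← Nat.cast_sum,
    MvPowerSeries.coeff_C, ← Finsupp.degree_eq_sum]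
  split_ifs with hm
  · simp [hm]
  · rw [zero_add, mul_inv_cancel_left₀]
    exact Nat.cast_ne_zero.2 ((Finsupp.degree_eq_zero_iff m).not.2 hm)

/-- No continuity of `D` is assumed: writing f = f(0) + ∑ xᵢ fᵢ gives D f = ∑ xᵢ D fᵢ, so all values
of `D` gain one order at each step. -/
theorem derivation_eq_zero [CharZero K] (D : FormalVectorField K n)
    (h : ∀ i, D (MvPowerSeries.X i) = 0) : D = 0 := by
  suffices ∀ N f, D f ∈ orderGE K n N from
    Derivation.ext fun f => eq_zero_of_mem_orderGE fun N => this N f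
  intro N
  induction N with
  | zero => exact fun f => mem_orderGE_zero _
  | succ N ih =>
    intro f
    obtain ⟨f', hf⟩ := exists_eq_C_add_sum f
    have hD : D f = ∑ i, MvPowerSeries.X i * D (f' i) := by
      conv_lhs => rw [hf]
      rw [map_add, MvPowerSeries.c_eq_algebraMap, Derivation.map_algebraMap, zero_add, map_sum]
      refine Finset.sum_congr rfl fun i _ => ?_
      rw [Derivation.leibniz, h, smul_zero, add_zero, smul_eq_mul]
    rw [hD]
    refine Submodule.sum_mem _ fun i _ m hm => ?_
    rw [← smulSeries_eq_mul, coeff_eq_vcoeff]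
    by_cases hi : m i = 0
    · rw [vcoeff_X_smulSeries_of_eq_zero _ hi]
    · obtain ⟨k, rfl⟩ := exists_eq_add_single hi
      rw [vcoeff_X_smulSeries_add]
      exact ih (f' i) k (by simpa using hm)

theorem derivation_ext [CharZero K] {D D' : FormalVectorField K n}
    (h : ∀ i, D (MvPowerSeries.X i) = D' (MvPowerSeries.X i)) : D = D' :=
  sub_eq_zero.1 (derivation_eq_zero _ fun i => by rw [Derivation.sub_apply, h, sub_self])

/-- The vector field with prescribed components. -/
noncomputable def ofComponents (v : Fin n → MvPowerSeries (Fin n) K) : FormalVectorField K n :=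
  ∑ i, v i • MvPowerSeries.pderiv K i

theorem ofComponents_apply (v : Fin n → MvPowerSeries (Fin n) K) (f : MvPowerSeries (Fin n) K) :
    ofComponents v f = ∑ i, v i * MvPowerSeries.pderiv K i f := by
  rw [ofComponents, ← Derivation.coeFnAddMonoidHom_apply, map_sum, Finset.sum_apply]
  rfl

theorem ofComponents_X (v : Fin n → MvPowerSeries (Fin n) K) (j : Fin n) :
    ofComponents v (MvPowerSeries.X j) = v j := by
  rw [ofComponents_apply, Finset.sum_eq_single j]
  · rw [MvPowerSeries.pderiv_X_self, mul_one]
  · intro i _ hi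
    rw [MvPowerSeries.pderiv_X_of_ne hi.symm, mul_zero]
  · simp

theorem derivation_apply [CharZero K] (D : FormalVectorField K n) (f : MvPowerSeries (Fin n) K) :
    D f = ∑ i, D (MvPowerSeries.X i) * MvPowerSeries.pderiv K i f := by
  rw [← ofComponents_apply fun i => D (MvPowerSeries.X i)]
  exact congrArg (fun D : FormalVectorField K n => D f)
    (derivation_ext fun i => (ofComponents_X (fun j => D (MvPowerSeries.X j)) i).symm)

theorem ord_nonneg_iff (D : FormalVectorField K n) : 0 ≤ FormalVectorField.ord D ↔
    ∀ i, MvPowerSeries.constantCoeff (D (MvPowerSeries.X i)) = 0 := by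
  have h : 0 ≤ FormalVectorField.ord D ↔ 1 ≤ ⨅ i : Fin n, (D (MvPowerSeries.X i)).order := by
    unfold FormalVectorField.ord
    generalize (⨅ i : Fin n, (D (MvPowerSeries.X i)).order) = a
    induction a with
    | top => simp
    | coe a =>
      rw [ENat.map_natCast, ← WithTop.coe_add, ← WithTop.coe_zero, WithTop.coe_le_coe,
        ← Nat.cast_one (R := ℕ∞), Nat.cast_le]
      omega
  rw [h, le_iInf_iff]
  exact forall_congr' fun i => MvPowerSeries.one_le_order_iff_constCoeff_eq_zero

/-- f - f(0) is a non-unit, and automorphisms preserve non-units. -/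
theorem constantCoeff_algEquiv
    (ψ : MvPowerSeries (Fin n) K ≃ₐ[K] MvPowerSeries (Fin n) K) (f : MvPowerSeries (Fin n) K) :
    MvPowerSeries.constantCoeff (ψ f) = MvPowerSeries.constantCoeff f := by
  by_contra hne
  have h1 : IsUnit (ψ f - algebraMap K _ (MvPowerSeries.constantCoeff f)) := by
    rw [MvPowerSeries.isUnit_iff_constantCoeff, isUnit_iff_ne_zero, map_sub,
      ← MvPowerSeries.c_eq_algebraMap, MvPowerSeries.constantCoeff_C]
    exact sub_ne_zero.2 hne
  have h2 : ψ f - algebraMap K _ (MvPowerSeries.constantCoeff f) =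
      ψ (f - algebraMap K _ (MvPowerSeries.constantCoeff f)) := by
    rw [map_sub, AlgEquiv.commutes]
  rw [h2, MulEquiv.isUnit_map, MvPowerSeries.isUnit_iff_constantCoeff, map_sub,
    ← MvPowerSeries.c_eq_algebraMap, MvPowerSeries.constantCoeff_C, sub_self] at h1
  exact not_isUnit_zero h1

end FormalSeries

/-! ### Rigidity of realisations through the order filtration -/

namespace IsRealisation

open FormalSeries
open Finsupp (single degree)

variable {K g : Type*} [Field K] [LieRing g] [LieAlgebra K g] {h : LieSubalgebra K g} {n : ℕ}
  {φ φ' : g →ₗ⁅K⁆ FormalVectorField K n}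

theorem mem_iff_constantCoeff (hφ : IsRealisation h φ) (x : g) :
    x ∈ h ↔ ∀ i, MvPowerSeries.constantCoeff (φ x (MvPowerSeries.X i)) = 0 :=
  (hφ.mem_iff x).trans (ord_nonneg_iff _)

/-- Evaluation at the origin has kernel `h`, so its image has dimension n, the codimension of `h`.
-/
theorem exists_frame (hφ : IsRealisation h φ) (v : Fin n → K) :
    ∃ x : g, ∀ j, MvPowerSeries.constantCoeff (φ x (MvPowerSeries.X j)) = v j := by
  let L : g →ₗ[K] Fin n → K := LinearMap.pi fun j =>
    { toFun := fun x => MvPowerSeries.constantCoeff (φ x (MvPowerSeries.X j))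
      map_add' := fun x y => by simp
      map_smul' := fun c x => by simp }
  have hker : LinearMap.ker L = h.toSubmodule := by
    ext x
    rw [LinearMap.mem_ker, LieSubalgebra.mem_toSubmodule, hφ.mem_iff_constantCoeff, funext_iff]
    rfl
  have hrange : LinearMap.range L = ⊤ := by
    apply Submodule.eq_top_of_finrank_eq
    rw [← L.quotKerEquivRange.finrank_eq, hker, hφ.transitive.codim_eq, Module.finrank_fin_fun]
  obtain ⟨x, hx⟩ := LinearMap.range_eq_top.1 hrange v
  exact ⟨x, fun j => congrFun hx j⟩

variable [CharZero K]

theorem constantCoeff_apply_eq_zero (hφ : IsRealisation h φ) {x : g} (hx : x ∈ h)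
    (f : MvPowerSeries (Fin n) K) : MvPowerSeries.constantCoeff (φ x f) = 0 := by
  rw [derivation_apply, map_sum]
  refine Finset.sum_eq_zero fun i _ => ?_
  rw [map_mul, (hφ.mem_iff_constantCoeff x).1 hx, zero_mul]

theorem mem_orderGE_succ_iff (hφ : IsRealisation h φ) (N : ℕ) (f : MvPowerSeries (Fin n) K) :
    f ∈ orderGE K n (N + 1) ↔
      MvPowerSeries.constantCoeff f = 0 ∧ ∀ x, φ x f ∈ orderGE K n N := by
  constructor
  · refine fun hf => ⟨hf 0 (by simp), fun x => ?_⟩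
    rw [derivation_apply]
    exact Submodule.sum_mem _ fun i _ => mul_mem_orderGE _ (pderiv_mem_orderGE hf i)
  · rintro ⟨h0, hN⟩
    suffices ∀ d ≤ N + 1, f ∈ orderGE K n d from this _ le_rfl
    intro d
    induction d with
    | zero => exact fun _ => mem_orderGE_zero f
    | succ d ih =>
      intro hd m hm
      have ihd := ih (by omega)
      obtain hm | hm := Nat.lt_succ_iff_lt_or_eq.1 hm
      · exact ihd m hm
      obtain rfl | ⟨i, hi⟩ : m = 0 ∨ ∃ i, m i ≠ 0 := by
        by_contra! hc
        exact hc.1 (Finsupp.ext hc.2)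
      · exact h0
      obtain ⟨k, rfl⟩ := exists_eq_add_single hi
      -- φ(x) equals ∂ᵢ at the origin. As f already has order at least d, the coefficient of φ(x) f
      -- at k is that of ∂ᵢ f, namely (kᵢ + 1) times the coefficient of f wanted.
      obtain ⟨x, hx⟩ := hφ.exists_frame (Pi.single i 1)
      have hk : degree k + 1 = d := by rw [← hm]; simp
      have hxk := hN x k (by omega)
      rw [derivation_apply, map_sum, Finset.sum_eq_single i] at hxk
      · rw [coeff_mul_of_mem_orderGE _ (pderiv_mem_orderGE (hk ▸ ihd) i), hx, Pi.single_eq_same,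
          one_mul, MvPowerSeries.coeff_pderiv] at hxk
        exact (mul_eq_zero.1 hxk).resolve_right (Nat.cast_add_one_ne_zero _)
      · intro j _ hj
        rw [coeff_mul_of_mem_orderGE _ (pderiv_mem_orderGE (hk ▸ ihd) j), hx,
          Pi.single_eq_of_ne hj, zero_mul]
      · simp

/-- A linear map between realisations compatible with the evaluations at the origin preserves and
reflects the order filtration. -/
theorem map_mem_orderGE_iff (hφ : IsRealisation h φ) (hφ' : IsRealisation h φ')
    {ψ : MvPowerSeries (Fin n) K →ₗ[K] MvPowerSeries (Fin n) K}
    (h0 : ∀ f, MvPowerSeries.constantCoeff (ψ f) = MvPowerSeries.constantCoeff f)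
    (hψ : ∀ x f, ψ (φ x f) = φ' x (ψ f)) (N : ℕ) (f : MvPowerSeries (Fin n) K) :
    ψ f ∈ orderGE K n N ↔ f ∈ orderGE K n N := by
  induction N generalizing f with
  | zero => simp [mem_orderGE_zero]
  | succ N ih =>
    rw [hφ'.mem_orderGE_succ_iff N (ψ f), hφ.mem_orderGE_succ_iff N f, h0]
    exact and_congr_right fun _ => forall_congr' fun x => by rw [← hψ, ih]

/-- The defect of multiplicativity vanishes at the origin, and by Leibniz its derivative along φ'(x)
is a sum of two such defects. -/
theorem map_mul_of_intertwines (hφ' : IsRealisation h φ')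
    {ψ : MvPowerSeries (Fin n) K →ₗ[K] MvPowerSeries (Fin n) K}
    (h0 : ∀ f, MvPowerSeries.constantCoeff (ψ f) = MvPowerSeries.constantCoeff f)
    (hψ : ∀ x f, ψ (φ x f) = φ' x (ψ f)) (f f' : MvPowerSeries (Fin n) K) :
    ψ (f * f') = ψ f * ψ f' := by
  suffices ∀ N f f', ψ (f * f') - ψ f * ψ f' ∈ orderGE K n N from
    sub_eq_zero.1 (eq_zero_of_mem_orderGE fun N => this N f f')
  intro N
  induction N with
  | zero => exact fun f f' => mem_orderGE_zero _
  | succ N ih =>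
    refine fun f f' => (hφ'.mem_orderGE_succ_iff N _).2 ⟨by simp [h0], fun x => ?_⟩
    have : φ' x (ψ (f * f') - ψ f * ψ f') =
        (ψ (f * φ x f') - ψ f * ψ (φ x f')) + (ψ (f' * φ x f) - ψ f' * ψ (φ x f)) := by
      rw [map_sub, ← hψ, Derivation.leibniz, Derivation.leibniz, ← hψ, ← hψ, map_add]
      simp only [smul_eq_mul]
      ring
    rw [this]
    exact Submodule.add_mem _ (ih _ _) (ih _ _)

theorem eq_zero_of_intertwines (hφ' : IsRealisation h φ')
    {δ : MvPowerSeries (Fin n) K → MvPowerSeries (Fin n) K}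
    (h0 : ∀ f, MvPowerSeries.constantCoeff (δ f) = 0)
    (hδ : ∀ x f, δ (φ x f) = φ' x (δ f)) (f : MvPowerSeries (Fin n) K) : δ f = 0 := by
  suffices ∀ N f, δ f ∈ orderGE K n N from eq_zero_of_mem_orderGE fun N => this N f
  intro N
  induction N with
  | zero => exact fun f => mem_orderGE_zero _
  | succ N ih =>
    refine fun f => (hφ'.mem_orderGE_succ_iff N _).2 ⟨h0 f, fun x => ?_⟩
    rw [← hδ]
    exact ih _

/-- Since y(xf) = [y, x]f + x(yf) and [y, x] stays in the ideal, the order of xf can be raised for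
all x in the ideal and all f together. -/
theorem apply_eq_zero_of_mem_ideal (hφ : IsRealisation h φ) {I : LieIdeal K g}
    (hI : (I : Set g) ⊆ h) {x : g} (hx : x ∈ I) : φ x = 0 := by
  suffices ∀ N, ∀ x ∈ I, ∀ f, φ x f ∈ orderGE K n N from
    Derivation.ext fun f => eq_zero_of_mem_orderGE fun N => this N x hx f
  intro N
  induction N with
  | zero => exact fun x _ f => mem_orderGE_zero _
  | succ N ih =>
    refine fun x hx f => (hφ.mem_orderGE_succ_iff N _).2
      ⟨hφ.constantCoeff_apply_eq_zero (hI hx) f, fun y => ?_⟩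
    have : φ y (φ x f) = φ ⁅y, x⁆ f + φ x (φ y f) := by
      rw [LieHom.map_lie, Derivation.commutator_apply, sub_add_cancel]
    rw [this]
    exact Submodule.add_mem _ (ih _ (lie_mem_right K g I y x hx) _) (ih _ hx _)

theorem isGreatest_ker (hφ : IsRealisation h φ) :
    IsGreatest {I : LieIdeal K g | (I : Set g) ⊆ (h : Set g)} φ.ker := by
  refine ⟨fun x hx => ?_, fun I hI x hx => ?_⟩
  · have hx' : φ x = 0 := LieHom.mem_ker.1 hx
    refine (hφ.mem_iff_constantCoeff x).2 fun i => ?_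
    rw [hx', Derivation.zero_apply, map_zero]
  · exact LieHom.mem_ker.2 (hφ.apply_eq_zero_of_mem_ideal hI hx)

theorem injective_iff_isEffectivePair (hφ : IsRealisation h φ) :
    Function.Injective φ ↔ IsEffectivePair h := by
  rw [← LieHom.ker_eq_bot]
  refine ⟨fun hk I hI => ?_, fun he => he _ hφ.isGreatest_ker.1⟩
  exact le_bot_iff.1 (hk ▸ hφ.isGreatest_ker.2 hI)

theorem algEquiv_eq_of_intertwines (hφ' : IsRealisation h φ')
    {ψ ψ' : MvPowerSeries (Fin n) K ≃ₐ[K] MvPowerSeries (Fin n) K}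
    (hψ : ∀ x f, ψ (φ x f) = φ' x (ψ f)) (hψ' : ∀ x f, ψ' (φ x f) = φ' x (ψ' f)) : ψ = ψ' :=
  AlgEquiv.ext fun f => sub_eq_zero.1 <|
    hφ'.eq_zero_of_intertwines (φ := φ) (δ := fun f => ψ f - ψ' f)
      (fun f => by rw [map_sub, constantCoeff_algEquiv, constantCoeff_algEquiv, sub_self])
      (fun x f => by rw [hψ, hψ', map_sub]) f

/-- An intertwiner compatible with the evaluations at the origin is bijective. -/
theorem bijective_of_intertwines (hφ : IsRealisation h φ) (hφ' : IsRealisation h φ')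
    {ψ : MvPowerSeries (Fin n) K →ₗ[K] MvPowerSeries (Fin n) K}
    (h0 : ∀ f, MvPowerSeries.constantCoeff (ψ f) = MvPowerSeries.constantCoeff f)
    (hψ : ∀ x f, ψ (φ x f) = φ' x (ψ f)) : Function.Bijective ψ := by
  have hmem := hφ.map_mem_orderGE_iff hφ' h0 hψ
  refine ⟨fun f f' hf => ?_, fun f' => ?_⟩
  · refine sub_eq_zero.1 (eq_zero_of_mem_orderGE fun N => (hmem N _).1 ?_)
    rw [map_sub, hf, sub_self]
    exact Submodule.zero_mem _
  have hsurj : ∀ N, ∃ f, ψ f - f' ∈ orderGE K n N := by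
    intro N
    let S := {m : Fin n →₀ ℕ // degree m < N}
    have : Finite S := (Finsupp.finite_of_degree_le (σ := Fin n) N).subset
      (fun m (hm : degree m < N) => hm.le)
    let ext : (S → K) →ₗ[K] MvPowerSeries (Fin n) K :=
      LinearMap.pi (R := K) (φ := fun _ : Fin n →₀ ℕ => K) fun m =>
        if hm : degree m < N then LinearMap.proj (⟨m, hm⟩ : S) else 0
    let res : MvPowerSeries (Fin n) K →ₗ[K] (S → K) :=
      LinearMap.pi fun m => MvPowerSeries.coeff m.1
    have hres : ∀ f, res f = 0 ↔ f ∈ orderGE K n N := fun f =>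
      ⟨fun h m hm => congrFun h ⟨m, hm⟩, fun h => funext fun m => h m.1 m.2⟩
    have hext : ∀ c (m : S), MvPowerSeries.coeff m.1 (ext c) = c m := fun c m => by
      rw [coeff_eq_vcoeff]
      change (if hm : degree m.1 < N then LinearMap.proj (⟨m.1, hm⟩ : S)
        else (0 : (S → K) →ₗ[K] K)) c = c m
      rw [dif_pos m.2]
      rfl
    -- On polynomials of degree below N, ψ followed by truncation is injective because ψ reflects
    -- the order; finite dimension makes it surjective.
    have hinj : Function.Injective (res ∘ₗ ψ ∘ₗ ext) := by
      refine (injective_iff_map_eq_zero _).2 fun c hc => ?_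
      have := (hmem N _).1 ((hres _).1 hc)
      funext m
      rw [← hext c m]
      exact this m.1 m.2
    obtain ⟨c, hc⟩ := LinearMap.injective_iff_surjective.1 hinj (res f')
    refine ⟨ext c, (hres _).1 ?_⟩
    rw [map_sub, sub_eq_zero]
    exact hc
  choose F hF using hsurj
  have hmono : ∀ {M N : ℕ}, M ≤ N → orderGE K n N ≤ orderGE K n M :=
    fun hMN f hf m hm => hf m (by omega)
  have hcompat : ∀ M N, M ≤ N → F N - F M ∈ orderGE K n M := by
    intro M N hMN
    rw [← hmem, map_sub, ← sub_sub_sub_cancel_right _ _ f']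
    exact Submodule.sub_mem _ (hmono hMN (hF N)) (hF M)
  -- The coefficient at m is the same in every `F N` with N > degree m.
  let f : MvPowerSeries (Fin n) K := fun m => MvPowerSeries.coeff m (F (degree m + 1))
  have hf : ∀ N, f - F N ∈ orderGE K n N := by
    intro N m hm
    have := hcompat (degree m + 1) N hm m (Nat.lt_succ_self _)
    rw [map_sub, sub_eq_zero] at this
    rw [map_sub, this]
    exact sub_self _
  refine ⟨f, sub_eq_zero.1 (eq_zero_of_mem_orderGE fun N => ?_)⟩
  rw [← sub_add_sub_cancel _ (ψ (F N)), ← map_sub]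
  exact Submodule.add_mem _ ((hmem N _).2 (hf N)) (hF N)

end IsRealisation

/-! ### The canonical realisation and the orbit map -/

namespace FormalSeries

open Finsupp (single degree)
attribute [local instance] LieRing.ofAssociativeRing LieAlgebra.ofAssociativeAlgebra

variable {K : Type*} [Field K] {n : ℕ}
variable {g : Type*} [LieRing g] [LieAlgebra K g]
variable {V : Type*} [AddCommGroup V] [Module K V]

/-- The value of the Maurer–Cartan form on the vector field with components `u`. -/
noncomputable def maurerCartanApply (b : Fin n → g) :
    (Fin n → MvPowerSeries (Fin n) K) →ₗ[K] MvPowerSeries (Fin n) g :=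
  ∑ i, (smulSeries (V := g)).flip (maurerCartan K b i) ∘ₗ LinearMap.proj i

theorem maurerCartanApply_eq (b : Fin n → g) (u : Fin n → MvPowerSeries (Fin n) K) :
    maurerCartanApply b u = ∑ i, smulSeries (u i) (maurerCartan K b i) := by
  simp [maurerCartanApply]

/-- The derivative of a vector-valued power series along the vector field with components `u`. -/
noncomputable def derAlong (u : Fin n → MvPowerSeries (Fin n) K) :
    MvPowerSeries (Fin n) V →ₗ[K] MvPowerSeries (Fin n) V :=
  ∑ i, smulSeries (u i) ∘ₗ pd K i

theorem derAlong_apply (u : Fin n → MvPowerSeries (Fin n) K) (a : MvPowerSeries (Fin n) V) :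
    derAlong u a = ∑ i, smulSeries (u i) (pd K i a) := by
  simp [derAlong]

theorem derAlong_smulSeries (u : Fin n → MvPowerSeries (Fin n) K) (f : MvPowerSeries (Fin n) K)
    (a : MvPowerSeries (Fin n) V) :
    derAlong u (smulSeries f a) =
      smulSeries (ofComponents u f) a + smulSeries f (derAlong u a) := by
  simp only [derAlong_apply, pd_smulSeries, map_add, Finset.sum_add_distrib, ofComponents_apply,
    map_sum, LinearMap.sum_apply, smulSeries_smulSeries]
  simp only [mul_comm]

theorem mapCoeff_derAlong (u : Fin n → MvPowerSeries (Fin n) K) (ℓ : g →ₗ[K] K)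
    (a : MvPowerSeries (Fin n) g) :
    mapCoeff ℓ (derAlong u a) = ofComponents u (mapCoeff ℓ a) := by
  simp only [derAlong_apply, ofComponents_apply, map_sum, mapCoeff_smulSeries, mapCoeff_pd,
    smulSeries_eq_mul, pd_eq_pderiv]

theorem derAlong_maurerCartanApply (b : Fin n → g) (u v : Fin n → MvPowerSeries (Fin n) K) :
    derAlong u (maurerCartanApply b v) = maurerCartanApply b (fun j => ofComponents u (v j)) +
      ∑ i, ∑ j, smulSeries (u i * v j) (pd K i (maurerCartan K b j)) := by
  simp only [maurerCartanApply_eq, map_sum, derAlong_smulSeries, Finset.sum_add_distrib]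
  rw [Finset.sum_comm (f := fun i j => smulSeries (u i * v j) (pd K i (maurerCartan K b j)))]
  simp only [derAlong_apply, map_sum, smulSeries_smulSeries, mul_comm]

theorem act_maurerCartanApply (b : Fin n → g) (ρ : g →ₗ⁅K⁆ Module.End K V)
    (u : Fin n → MvPowerSeries (Fin n) K) (F : MvPowerSeries (Fin n) V) :
    act ρ (maurerCartanApply b u) F = ∑ i, smulSeries (u i) (act ρ (maurerCartan K b i) F) := by
  simp only [maurerCartanApply_eq, map_sum, LinearMap.sum_apply, act_smulSeries_left]

/-- The matrix of the Maurer–Cartan form modulo the common kernel of the functionals `ℓ`. -/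
noncomputable def formMatrix (b : Fin n → g) (ℓ : Fin n → g →ₗ[K] K) :
    Matrix (Fin n) (Fin n) (MvPowerSeries (Fin n) K) :=
  fun j i => mapCoeff (ℓ j) (maurerCartan K b i)

theorem mapCoeff_maurerCartanApply (b : Fin n → g) (ℓ : Fin n → g →ₗ[K] K)
    (u : Fin n → MvPowerSeries (Fin n) K) (j : Fin n) :
    mapCoeff (ℓ j) (maurerCartanApply b u) = (formMatrix b ℓ).mulVec u j := by
  simp only [maurerCartanApply_eq, map_sum, mapCoeff_smulSeries, smulSeries_eq_mul,
    Matrix.mulVec, dotProduct, formMatrix, mul_comm]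

theorem map_formMatrix {b : Fin n → g} {ℓ : Fin n → g →ₗ[K] K}
    (hℓ : ∀ i j, ℓ j (b i) = if j = i then 1 else 0) :
    (formMatrix b ℓ).map MvPowerSeries.constantCoeff = 1 := by
  ext j i
  rw [Matrix.map_apply, Matrix.one_apply, ← hℓ, ← vcoeff_zero_maurerCartan (K := K) b i]
  rfl

/-- This is where closure of `h` under the bracket enters the construction. -/
theorem mapCoeff_act_ad_eq_zero {ℓ : Fin n → g →ₗ[K] K} {h : LieSubalgebra K g}
    (hh : ∀ x, x ∈ h ↔ ∀ j, ℓ j x = 0) {a a' : MvPowerSeries (Fin n) g}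
    (ha : ∀ j, mapCoeff (ℓ j) a = 0) (ha' : ∀ j, mapCoeff (ℓ j) a' = 0) (j : Fin n) :
    mapCoeff (ℓ j) (act (LieAlgebra.ad K g) a a') = 0 := by
  refine vext K fun m => ?_
  rw [vcoeff_mapCoeff, act, vcoeff_cauchy, map_sum, map_zero]
  refine Finset.sum_eq_zero fun p _ => ?_
  have h1 : vcoeff K p.1 a ∈ h := (hh _).2 fun j => congrArg (vcoeff K p.1) (ha j)
  have h2 : vcoeff K p.2 a' ∈ h := (hh _).2 fun j => congrArg (vcoeff K p.2) (ha' j)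
  exact (hh _).1 (h.lie_mem h1 h2) j

theorem exists_adapted_frame {h : LieSubalgebra K g} (hgh : IsTransitivePair h n) :
    ∃ (b : Fin n → g) (ℓ : Fin n → g →ₗ[K] K), (∀ i j, ℓ j (b i) = if j = i then 1 else 0) ∧
      ∀ x, x ∈ h ↔ ∀ j, ℓ j x = 0 := by
  have := hgh.finite_codim
  let B := Module.finBasisOfFinrankEq K (g ⧸ h.toSubmodule) hgh.codim_eq
  choose b hb using fun i => h.toSubmodule.mkQ_surjective (B i)
  refine ⟨b, fun j => B.coord j ∘ₗ h.toSubmodule.mkQ, fun i j => ?_, fun x => ?_⟩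
  · rw [LinearMap.comp_apply, hb, Module.Basis.coord_apply, Module.Basis.repr_self,
      Finsupp.single_apply]
    simp only [eq_comm]
  · rw [← LieSubalgebra.mem_toSubmodule, ← Submodule.Quotient.mk_eq_zero,
      ← B.forall_coord_eq_zero_iff]
    rfl

/-- The representation on power series attached to a Lie algebra of vector fields. -/
noncomputable def toEndSeries (φ : g →ₗ⁅K⁆ FormalVectorField K n) :
    g →ₗ⁅K⁆ Module.End K (MvPowerSeries (Fin n) K) where
  toFun x := (φ x : MvPowerSeries (Fin n) K →ₗ[K] MvPowerSeries (Fin n) K)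
  map_add' x y := by rw [map_add]; rfl
  map_smul' c x := by rw [map_smul]; rfl
  map_lie' {x y} := by
    refine LinearMap.ext fun f => ?_
    change φ ⁅x, y⁆ f = φ x (φ y f) - φ y (φ x f)
    rw [LieHom.map_lie, Derivation.commutator_apply]

/-- The pull-back of functions along the orbit map `exp (∑ xᵢ bᵢ)` of the origin. -/
noncomputable def orbitPullback (b : Fin n → g) (φ : g →ₗ⁅K⁆ FormalVectorField K n) :
    MvPowerSeries (Fin n) K →ₗ[K] MvPowerSeries (Fin n) K :=
  mapCoeff (MvPowerSeries.coeff (0 : Fin n →₀ ℕ)) ∘ₗ flow b (toEndSeries φ)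

theorem constantCoeff_orbitPullback (b : Fin n → g) (φ : g →ₗ⁅K⁆ FormalVectorField K n)
    (f : MvPowerSeries (Fin n) K) :
    MvPowerSeries.constantCoeff (orbitPullback b φ f) = MvPowerSeries.constantCoeff f := by
  conv_rhs => rw [← vcoeff_zero_flow b (toEndSeries φ) f]
  rfl

theorem isUnit_det_formMatrix {b : Fin n → g} {ℓ : Fin n → g →ₗ[K] K}
    (hℓ : ∀ i j, ℓ j (b i) = if j = i then 1 else 0) : IsUnit (formMatrix b ℓ).det := by
  rw [MvPowerSeries.isUnit_iff_constantCoeff, RingHom.map_det, RingHom.mapMatrix_apply,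
    map_formMatrix hℓ, Matrix.det_one]
  exact isUnit_one

/-- The components of the canonical vector field attached to an element of the Lie algebra. -/
noncomputable def canonicalComponents (b : Fin n → g) (ℓ : Fin n → g →ₗ[K] K) :
    g →ₗ[K] (Fin n → MvPowerSeries (Fin n) K) :=
  -- Solves ω(u) ≡ Ad(exp X) x modulo `h` for u.
  (Matrix.mulVecLin (formMatrix b ℓ)⁻¹).restrictScalars K ∘ₗ
    LinearMap.pi fun j => mapCoeff (ℓ j) ∘ₗ flow b (LieAlgebra.ad K g)

theorem formMatrix_mulVec_canonicalComponents {b : Fin n → g} {ℓ : Fin n → g →ₗ[K] K}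
    (hℓ : ∀ i j, ℓ j (b i) = if j = i then 1 else 0) (x : g) :
    (formMatrix b ℓ).mulVec (canonicalComponents b ℓ x) =
      fun j => mapCoeff (ℓ j) (flow b (LieAlgebra.ad K g) x) := by
  change (formMatrix b ℓ).mulVec ((formMatrix b ℓ)⁻¹.mulVec _) = _
  rw [Matrix.mulVec_mulVec, Matrix.mul_nonsing_inv _ (isUnit_det_formMatrix hℓ), Matrix.one_mulVec]
  rfl

theorem constantCoeff_canonicalComponents {b : Fin n → g} {ℓ : Fin n → g →ₗ[K] K}
    (hℓ : ∀ i j, ℓ j (b i) = if j = i then 1 else 0) (x : g) (j : Fin n) :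
    MvPowerSeries.constantCoeff (canonicalComponents b ℓ x j) = ℓ j x := by
  have h := congrArg MvPowerSeries.constantCoeff
    (congrFun (formMatrix_mulVec_canonicalComponents hℓ x) j)
  rw [RingHom.map_mulVec, map_formMatrix hℓ, Matrix.one_mulVec] at h
  refine h.trans ?_
  conv_rhs => rw [← vcoeff_zero_flow b (LieAlgebra.ad K g) x]
  rfl

/-- The component of the flow tangent to the stabiliser. -/
noncomputable def isotropyPart (b : Fin n → g) (ℓ : Fin n → g →ₗ[K] K) (x : g) :
    MvPowerSeries (Fin n) g :=
  flow b (LieAlgebra.ad K g) x - maurerCartanApply b (canonicalComponents b ℓ x)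

theorem mapCoeff_isotropyPart {b : Fin n → g} {ℓ : Fin n → g →ₗ[K] K}
    (hℓ : ∀ i j, ℓ j (b i) = if j = i then 1 else 0) (x : g) (j : Fin n) :
    mapCoeff (ℓ j) (isotropyPart b ℓ x) = 0 := by
  rw [isotropyPart, map_sub, mapCoeff_maurerCartanApply,
    formMatrix_mulVec_canonicalComponents hℓ, sub_self]

variable [CharZero K]

theorem derAlong_flow (b : Fin n → g) (ρ : g →ₗ⁅K⁆ Module.End K V)
    (u : Fin n → MvPowerSeries (Fin n) K) (v : V) :
    derAlong u (flow b ρ v) = act ρ (maurerCartanApply b u) (flow b ρ v) := by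
  simp only [derAlong_apply, act_maurerCartanApply, pd_flow]

/-- The Maurer–Cartan equation contracted with two vector fields, as in the invariant formula for
dω(u, v). -/
theorem derAlong_maurerCartanApply_sub (b : Fin n → g) (u v : Fin n → MvPowerSeries (Fin n) K) :
    derAlong u (maurerCartanApply b v) - derAlong v (maurerCartanApply b u) =
      maurerCartanApply b (fun j => ofComponents u (v j) - ofComponents v (u j)) +
        act (LieAlgebra.ad K g) (maurerCartanApply b u) (maurerCartanApply b v) := by
  have h1 : (fun j => ofComponents u (v j) - ofComponents v (u j)) =
      (fun j => ofComponents u (v j)) - fun j => ofComponents v (u j) := rfl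
  have h2 : act (LieAlgebra.ad K g) (maurerCartanApply b u) (maurerCartanApply b v) =
      ∑ i, ∑ j, smulSeries (u i * v j) (pd K i (maurerCartan K b j)) -
        ∑ i, ∑ j, smulSeries (v i * u j) (pd K i (maurerCartan K b j)) := by
    rw [Finset.sum_comm (f := fun i j => smulSeries (v i * u j) (pd K i (maurerCartan K b j))),
      act_maurerCartanApply, ← Finset.sum_sub_distrib]
    refine Finset.sum_congr rfl fun i _ => ?_
    rw [maurerCartanApply_eq, map_sum, map_sum, ← Finset.sum_sub_distrib]
    refine Finset.sum_congr rfl fun j _ => ?_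
    rw [act_smulSeries_right, smulSeries_smulSeries, mul_comm (v j), ← map_sub,
      pd_maurerCartan_sub]
  rw [derAlong_maurerCartanApply, derAlong_maurerCartanApply, h1, map_sub, h2]
  abel

theorem canonicalComponents_lie {b : Fin n → g} {ℓ : Fin n → g →ₗ[K] K} {h : LieSubalgebra K g}
    (hℓ : ∀ i j, ℓ j (b i) = if j = i then 1 else 0) (hh : ∀ x, x ∈ h ↔ ∀ j, ℓ j x = 0)
    (x y : g) : canonicalComponents b ℓ ⁅x, y⁆ = fun j =>
      ofComponents (canonicalComponents b ℓ x) (canonicalComponents b ℓ y j) -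
        ofComponents (canonicalComponents b ℓ y) (canonicalComponents b ℓ x j) := by
  set u := canonicalComponents b ℓ x with hu
  set v := canonicalComponents b ℓ y with hv
  set w := fun j => ofComponents u (v j) - ofComponents v (u j) with hw
  set ad := LieAlgebra.ad K g with had
  have hx : maurerCartanApply b u = flow b ad x - isotropyPart b ℓ x := by
    rw [isotropyPart, sub_sub_cancel]
  have hy : maurerCartanApply b v = flow b ad y - isotropyPart b ℓ y := by
    rw [isotropyPart, sub_sub_cancel]
  -- With ω(u) = Aₓ - pₓ, where Aₓ = Ad(exp X) x and pₓ has coefficients in `h`, the mixed brackets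
  -- cancel and [Aₓ, A_y] - [pₓ, p_y] remains. All terms except [Aₓ, A_y] vanish modulo `h`.
  have key : maurerCartanApply b w = flow b ad ⁅x, y⁆ -
      act ad (isotropyPart b ℓ x) (isotropyPart b ℓ y) -
        derAlong u (isotropyPart b ℓ y) + derAlong v (isotropyPart b ℓ x) := by
    have h1 := derAlong_maurerCartanApply_sub b u v
    have h2 : derAlong u (maurerCartanApply b v) =
        act ad (maurerCartanApply b u) (flow b ad y) - derAlong u (isotropyPart b ℓ y) := by
      rw [← derAlong_flow, hy, map_sub]
    have h3 : derAlong v (maurerCartanApply b u) =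
        act ad (maurerCartanApply b v) (flow b ad x) - derAlong v (isotropyPart b ℓ x) := by
      rw [← derAlong_flow, hx, map_sub]
    rw [← hw, ← had, h2, h3] at h1
    have h4 : act ad (flow b ad x) (flow b ad y) = flow b ad ⁅x, y⁆ := act_flow_flow b ad x y
    have h5 := act_ad_skew (K := K) (flow b ad y) (flow b ad x)
    have h6 := act_ad_skew (K := K) (isotropyPart b ℓ y) (flow b ad x)
    rw [← had] at h5 h6
    rw [eq_sub_of_add_eq h1.symm, hx, hy]
    simp only [map_sub, LinearMap.sub_apply, h5, h6, h4]
    abel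
  have hmul : (formMatrix b ℓ).mulVec (canonicalComponents b ℓ ⁅x, y⁆) =
      (formMatrix b ℓ).mulVec w := by
    rw [formMatrix_mulVec_canonicalComponents hℓ]
    funext j
    rw [← mapCoeff_maurerCartanApply, key, map_add, map_sub, map_sub, mapCoeff_derAlong,
      mapCoeff_derAlong, mapCoeff_isotropyPart hℓ, mapCoeff_isotropyPart hℓ, map_zero, map_zero,
      mapCoeff_act_ad_eq_zero hh (mapCoeff_isotropyPart hℓ x) (mapCoeff_isotropyPart hℓ y),
      sub_zero, sub_zero, add_zero]
  exact Matrix.mulVec_injective_of_isUnit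
    ((Matrix.isUnit_iff_isUnit_det _).2 (isUnit_det_formMatrix hℓ)) hmul

/-- The canonical realisation. -/
noncomputable def canonicalRealisation {b : Fin n → g} {ℓ : Fin n → g →ₗ[K] K}
    {h : LieSubalgebra K g} (hℓ : ∀ i j, ℓ j (b i) = if j = i then 1 else 0)
    (hh : ∀ x, x ∈ h ↔ ∀ j, ℓ j x = 0) : g →ₗ⁅K⁆ FormalVectorField K n where
  toFun x := ofComponents (canonicalComponents b ℓ x)
  map_add' x y := derivation_ext fun i => by
    rw [Derivation.add_apply, ofComponents_X, ofComponents_X, ofComponents_X, map_add,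
      Pi.add_apply]
  map_smul' c x := derivation_ext fun i => by
    rw [Derivation.smul_apply, ofComponents_X, ofComponents_X, map_smul, Pi.smul_apply,
      RingHom.id_apply]
  map_lie' {x y} := derivation_ext fun i => by
    rw [Derivation.commutator_apply, ofComponents_X, ofComponents_X, ofComponents_X,
      canonicalComponents_lie hℓ hh]

theorem isRealisation_canonicalRealisation {b : Fin n → g} {ℓ : Fin n → g →ₗ[K] K}
    {h : LieSubalgebra K g} (hgh : IsTransitivePair h n)
    (hℓ : ∀ i j, ℓ j (b i) = if j = i then 1 else 0)
    (hh : ∀ x, x ∈ h ↔ ∀ j, ℓ j x = 0) : IsRealisation h (canonicalRealisation hℓ hh) where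
  transitive := hgh
  mem_iff x := by
    rw [ord_nonneg_iff, hh]
    refine forall_congr' fun j => ?_
    rw [← constantCoeff_canonicalComponents hℓ x j,
      ← ofComponents_X (canonicalComponents b ℓ x) j]
    rfl

/-- exp X (xf) = (Ad(exp X) x) exp X f, and Ad(exp X) x = ω(u) + p. Evaluation at the origin kills
the p-part, as its coefficients lie in `h`; the ω(u)-part is the derivative of exp X f along u. -/
theorem orbitPullback_intertwines {b : Fin n → g} {ℓ : Fin n → g →ₗ[K] K}
    {h : LieSubalgebra K g} (hℓ : ∀ i j, ℓ j (b i) = if j = i then 1 else 0)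
    (hh : ∀ x, x ∈ h ↔ ∀ j, ℓ j x = 0) {φ : g →ₗ⁅K⁆ FormalVectorField K n}
    (hφ : IsRealisation h φ) (x : g) (f : MvPowerSeries (Fin n) K) :
    orbitPullback b φ (φ x f) = canonicalRealisation hℓ hh x (orbitPullback b φ f) := by
  have h1 : flow b (toEndSeries φ) (φ x f) =
      act (toEndSeries φ) (flow b (LieAlgebra.ad K g) x) (flow b (toEndSeries φ) f) :=
    (act_flow_flow b (toEndSeries φ) x f).symm
  have h2 : flow b (LieAlgebra.ad K g) x =
      maurerCartanApply b (canonicalComponents b ℓ x) + isotropyPart b ℓ x := by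
    rw [isotropyPart, add_sub_cancel]
  have h3 : mapCoeff (MvPowerSeries.coeff (R := K) (0 : Fin n →₀ ℕ))
      (act (toEndSeries φ) (isotropyPart b ℓ x) (flow b (toEndSeries φ) f)) = 0 := by
    refine vext K fun m => ?_
    rw [vcoeff_mapCoeff, act, vcoeff_cauchy, map_sum, map_zero]
    refine Finset.sum_eq_zero fun p _ => ?_
    have hp : vcoeff K p.1 (isotropyPart b ℓ x) ∈ h :=
      (hh _).2 fun j => congrArg (vcoeff K p.1) (mapCoeff_isotropyPart hℓ x j)
    exact hφ.constantCoeff_apply_eq_zero hp _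
  change mapCoeff (MvPowerSeries.coeff (R := K) (0 : Fin n →₀ ℕ))
    (flow b (toEndSeries φ) (φ x f)) = ofComponents (canonicalComponents b ℓ x)
      (mapCoeff (MvPowerSeries.coeff (R := K) (0 : Fin n →₀ ℕ)) (flow b (toEndSeries φ) f))
  rw [h1, h2, map_add, LinearMap.add_apply, map_add, h3, add_zero, ← derAlong_flow,
    derAlong_apply, ofComponents_apply, map_sum]
  refine Finset.sum_congr rfl fun i _ => ?_
  rw [mapCoeff_smulSeries, smulSeries_eq_mul, mapCoeff_pd, pd_eq_pderiv]

/-- Every realisation is equivalent to the canonical one. -/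
theorem exists_algEquiv_canonicalRealisation {b : Fin n → g} {ℓ : Fin n → g →ₗ[K] K}
    {h : LieSubalgebra K g} (hgh : IsTransitivePair h n)
    (hℓ : ∀ i j, ℓ j (b i) = if j = i then 1 else 0)
    (hh : ∀ x, x ∈ h ↔ ∀ j, ℓ j x = 0) {φ : g →ₗ⁅K⁆ FormalVectorField K n}
    (hφ : IsRealisation h φ) :
    ∃ ψ : MvPowerSeries (Fin n) K ≃ₐ[K] MvPowerSeries (Fin n) K,
      ∀ x f, ψ (φ x f) = canonicalRealisation hℓ hh x (ψ f) := by
  have hc := isRealisation_canonicalRealisation hgh hℓ hh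
  have h0 := constantCoeff_orbitPullback b φ
  have hi := orbitPullback_intertwines hℓ hh hφ
  have hbij := hφ.bijective_of_intertwines hc h0 hi
  have hmul := hc.map_mul_of_intertwines h0 hi
  have hone : orbitPullback b φ 1 = 1 := by
    obtain ⟨f, hf⟩ := hbij.2 1
    have := hmul 1 f
    rwa [one_mul, hf, mul_one, eq_comm] at this
  exact ⟨AlgEquiv.ofBijective (AlgHom.ofLinearMap (orbitPullback b φ) hone hmul) hbij, hi⟩

end FormalSeries

theorem mainTheorem1 {K g : Type*} [Field K] [CharZero K] [LieRing g] [LieAlgebra K g]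
    (h : LieSubalgebra K g) (n : ℕ) (hgh : IsTransitivePair h n) :
    (∃ φ : g →ₗ⁅K⁆ FormalVectorField K n, IsRealisation h φ) ∧
    (∀ φ₁ φ₂ : g →ₗ⁅K⁆ FormalVectorField K n, IsRealisation h φ₁ → IsRealisation h φ₂ →
      ∃! ψ : MvPowerSeries (Fin n) K ≃ₐ[K] MvPowerSeries (Fin n) K,
        ∀ (X : g) (f : MvPowerSeries (Fin n) K), φ₂ X f = ψ (φ₁ X (ψ.symm f))) ∧
    (∀ φ : g →ₗ⁅K⁆ FormalVectorField K n, IsRealisation h φ →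
      IsGreatest {I : LieIdeal K g | (I : Set g) ⊆ (h : Set g)} φ.ker ∧
      (Function.Injective φ ↔ IsEffectivePair h)) := by
  obtain ⟨b, ℓ, hℓ, hh⟩ := FormalSeries.exists_adapted_frame hgh
  refine ⟨⟨_, FormalSeries.isRealisation_canonicalRealisation hgh hℓ hh⟩, fun φ₁ φ₂ h₁ h₂ => ?_,
    fun φ hφ => ⟨hφ.isGreatest_ker, hφ.injective_iff_isEffectivePair⟩⟩
  obtain ⟨ψ₁, hψ₁⟩ := FormalSeries.exists_algEquiv_canonicalRealisation hgh hℓ hh h₁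
  obtain ⟨ψ₂, hψ₂⟩ := FormalSeries.exists_algEquiv_canonicalRealisation hgh hℓ hh h₂
  -- Both realisations are compared through the canonical one.
  refine ⟨ψ₁.trans ψ₂.symm, fun X f => ?_, fun ψ hψ => ?_⟩
  · change _ = ψ₂.symm (ψ₁ (φ₁ X (ψ₁.symm (ψ₂ f))))
    rw [hψ₁, AlgEquiv.apply_symm_apply, ← hψ₂, AlgEquiv.symm_apply_apply]
  · refine h₂.algEquiv_eq_of_intertwines (φ := φ₁) (fun X f => ?_) fun X f => ?_
    · rw [hψ, AlgEquiv.symm_apply_apply]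
    · change ψ₂.symm (ψ₁ (φ₁ X f)) = φ₂ X (ψ₂.symm (ψ₁ f))
      rw [AlgEquiv.symm_apply_eq, hψ₂, AlgEquiv.apply_symm_apply, hψ₁]
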